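/- Let $X$ be a countable set, let $\mu$ be a $\sigma$-finite positive measure on the power set $2^X$, write $\mu(x)=\mu(\{x\})$ and $X_+=\{x\in X:\mu(x)\neq 0\}$, and let $\phi:X\to X$ be nonsingular, i.e. $\mu(\phi^{-1}(\Delta))=0$ whenever $\Delta\subseteq X$ and $\mu(\Delta)=0$. Let $C_\phi$ be the composition operator in the complex Hilbert space $\ell^2(\mu)=L^2(X,2^X,\mu)$ with domain $\{f\in\ell^2(\mu):f\circ\phi\in\ell^2(\mu)\}$ and $C_\phi f=f\circ\phi$. A sequence $\gamma$ of positive real numbers, with index set $I=\{1,\dots,n\}$ ($n\ge 1$, finite case) or $I=\mathbb{Z}$ (bi-infinite case), is called geometric if, in the finite case, it is constant and, in the bi-infinite case, there is a real $q$ with $\gamma_{k+1}=q\,\gamma_k$ for all $k\in\mathbb{Z}$. Let $\ell^2(\gamma)$ be the complex $L^2$-space of the measure on $2^I$ with mass $\gamma_k$ at each $k\in I$. The two-sided backward shift $S$ in $\ell^2(\gamma)$ is the operator $$(Sf)(k)=f(k+1),\qquad \mathcal{D}(S)=\Big\{f\in\ell^2(\gamma):\sum_{k\in I}|f(k+1)|^2\gamma_k<\infty\Big\},$$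 where in the finite case $k+1$ is read cyclically, that is, $n+1$ means $1$. Thus $S\chi_{\{k+1\}}=\chi_{\{k\}}$ for all $k\in I$. A closed densely defined operator $A$ in a Hilbert space is called normal if $A^*A=AA^*$, with equality of domains. The orthogonal sum $\bigoplus_i T_i$ of operators $T_i$ in $\mathcal{H}_i$ acts coordinatewise in $\bigoplus_i\mathcal{H}_i$, with domain $\{(f_i)\in\bigoplus_i\mathcal{H}_i:f_i\in\mathcal{D}(T_i)\text{ for all }i,\ \sum_i\|T_if_i\|^2<\infty\}$. Operators $A$ in $\mathcal{H}$ and $B$ in $\mathcal{K}$ are unitarily equivalent if there is a unitary $U:\mathcal{H}\to\mathcal{K}$ with $U\mathcal{D}(A)=\mathcal{D}(B)$ and $UAf=BUf$ for all $f\in\mathcal{D}(A)$. **Proposition 3.6.** $C_\phi$ is normal if and only if there exist a subset $\mathcal{J}$ of $X_+$ and a family $\{\gamma(x):x\in\mathcal{J}\}$ of geometric sequences (each finite or bi-infinite) of positive real numbers such that $C_\phi$ is unitarily equivalent to $\bigoplus_{x\in\mathcal{J}}S(x)$, where $S(x)$ is the two-sided backward shift in $\ell^2(\gamma(x))$. 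-/

import Mathlib

open MeasureTheory
open scoped ENNReal

noncomputable section

namespace LinearPMap

variable {H K L : Type*} [NormedAddCommGroup H] [InnerProductSpace ℂ H]
  [NormedAddCommGroup K] [InnerProductSpace ℂ K] [NormedAddCommGroup L] [InnerProductSpace ℂ L]

/-- The product `B A` of two unbounded operators, with its natural domain
`{f ∈ D(A) : A f ∈ D(B)}`. -/
def prodOp (B : K →ₗ.[ℂ] L) (A : H →ₗ.[ℂ] K) : H →ₗ.[ℂ] L where
  domain :=
    { carrier := {f | ∃ hf : f ∈ A.domain, A ⟨f, hf⟩ ∈ B.domain}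
      zero_mem' := ⟨A.domain.zero_mem, by
        have h : A ⟨0, A.domain.zero_mem⟩ = 0 := A.map_zero
        rw [h]; exact B.domain.zero_mem⟩
      add_mem' := by
        rintro f g ⟨hf, hAf⟩ ⟨hg, hAg⟩
        refine ⟨A.domain.add_mem hf hg, ?_⟩
        have h : A ⟨f + g, A.domain.add_mem hf hg⟩ = A ⟨f, hf⟩ + A ⟨g, hg⟩ :=
          A.map_add ⟨f, hf⟩ ⟨g, hg⟩
        rw [h]; exact B.domain.add_mem hAf hAg
      smul_mem' := by
        rintro c f ⟨hf, hAf⟩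
        refine ⟨A.domain.smul_mem c hf, ?_⟩
        have h : A ⟨c • f, A.domain.smul_mem c hf⟩ = c • A ⟨f, hf⟩ := A.map_smul c ⟨f, hf⟩
        rw [h]; exact B.domain.smul_mem c hAf }
  toFun :=
    { toFun := fun f => B ⟨A ⟨f.1, f.2.1⟩, f.2.2⟩
      map_add' := by
        intro f g
        rw [← B.map_add]
        congr 1
        exact Subtype.ext (A.map_add ⟨f.1, f.2.1⟩ ⟨g.1, g.2.1⟩)
      map_smul' := by
        intro c f
        rw [RingHom.id_apply, ← B.map_smul]
        congr 1
        exact Subtype.ext (A.map_smul c ⟨f.1, f.2.1⟩) }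

/-- A normal operator in a Hilbert space: closed, densely defined, and `A* A = A A*`
(equality of unbounded operators, that is, of the domains and of the values). -/
def IsNormalOp [CompleteSpace H] (A : H →ₗ.[ℂ] H) : Prop :=
  A.IsClosed ∧ Dense (A.domain : Set H) ∧ A.adjoint.prodOp A = A.prodOp A.adjoint

/-- Unitary equivalence of unbounded operators: a unitary `U` with `U D(A) = D(B)` and
`U A f = B U f` for all `f ∈ D(A)`. -/
def UnitarilyEquiv (A : H →ₗ.[ℂ] H) (B : K →ₗ.[ℂ] K) : Prop :=
  ∃ U : H ≃ₗᵢ[ℂ] K, (∀ f : H, f ∈ A.domain ↔ U f ∈ B.domain) ∧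
    ∀ (f : A.domain) (g : B.domain), (g : K) = U f → U (A f) = B g

/-- The orthogonal sum of operators `T i` in `G i`, acting in the Hilbert space direct sum of the
`G i`. Its domain is `{f : f i ∈ D(T i) for all i, ∑ i, ‖T i (f i)‖ ^ 2 < ∞}`. -/
def orthogonalSum {ι : Type*} {G : ι → Type*} [∀ i, NormedAddCommGroup (G i)]
    [∀ i, InnerProductSpace ℂ (G i)] (T : ∀ i, G i →ₗ.[ℂ] G i) : lp G 2 →ₗ.[ℂ] lp G 2 where
  domain :=
    { carrier := {f | ∃ hf : ∀ i, f i ∈ (T i).domain, Memℓp (fun i => T i ⟨f i, hf i⟩) 2}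
      zero_mem' := ⟨fun i => (T i).domain.zero_mem, by
        have h : (fun i => T i ⟨(0 : lp G 2) i, (T i).domain.zero_mem⟩) = 0 :=
          funext fun i => (T i).map_zero
        rw [h]; exact zero_memℓp⟩
      add_mem' := by
        rintro f g ⟨hf, hTf⟩ ⟨hg, hTg⟩
        refine ⟨fun i => (T i).domain.add_mem (hf i) (hg i), ?_⟩
        have h : (fun i => T i ⟨(f + g) i, (T i).domain.add_mem (hf i) (hg i)⟩) =
            (fun i => T i ⟨f i, hf i⟩) + fun i => T i ⟨g i, hg i⟩ :=
          funext fun i => (T i).map_add ⟨f i, hf i⟩ ⟨g i, hg i⟩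
        rw [h]; exact hTf.add hTg
      smul_mem' := by
        rintro c f ⟨hf, hTf⟩
        refine ⟨fun i => (T i).domain.smul_mem c (hf i), ?_⟩
        have h : (fun i => T i ⟨(c • f) i, (T i).domain.smul_mem c (hf i)⟩) =
            c • fun i => T i ⟨f i, hf i⟩ :=
          funext fun i => (T i).map_smul c ⟨f i, hf i⟩
        rw [h]; exact hTf.const_smul c }
  toFun :=
    { toFun := fun f => ⟨fun i => T i ⟨f.1 i, f.2.1 i⟩, f.2.2⟩
      map_add' := fun f g => lp.ext <| funext fun i =>
        (T i).map_add ⟨f.1 i, f.2.1 i⟩ ⟨g.1 i, g.2.1 i⟩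
      map_smul' := fun c f => lp.ext <| funext fun i => (T i).map_smul c ⟨f.1 i, f.2.1 i⟩ }

end LinearPMap

/-- The composition operator `C_φ f = f ∘ φ` in `L²(μ)`, with domain
`{f ∈ L²(μ) : f ∘ φ ∈ L²(μ)}`, for a nonsingular measurable `φ`. -/
def compOp {α : Type*} [MeasurableSpace α] (μ : Measure α) (φ : α → α)
    (hφ : Measure.QuasiMeasurePreserving φ μ μ) : Lp ℂ 2 μ →ₗ.[ℂ] Lp ℂ 2 μ where
  domain :=
    { carrier := {f | MemLp (f ∘ φ) 2 μ}
      zero_mem' := (MemLp.zero (ε := ℂ)).ae_eq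
        (hφ.ae_eq_comp (Lp.coeFn_zero ℂ 2 μ)).symm
      add_mem' := fun {f g} hf hg =>
        (MemLp.add hf hg).ae_eq (hφ.ae_eq_comp (Lp.coeFn_add f g)).symm
      smul_mem' := fun c f hf =>
        (MemLp.const_smul hf c).ae_eq (hφ.ae_eq_comp (Lp.coeFn_smul c f)).symm }
  toFun :=
    { toFun := fun f => MemLp.toLp (f.1 ∘ φ) f.2
      map_add' := fun f g => by
        rw [← MemLp.toLp_add]
        exact MemLp.toLp_congr _ _ (hφ.ae_eq_comp (Lp.coeFn_add f.1 g.1))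
      map_smul' := fun c f => by
        rw [RingHom.id_apply, ← MemLp.toLp_const_smul]
        exact MemLp.toLp_congr _ _ (hφ.ae_eq_comp (Lp.coeFn_smul c f.1)) }

/-- A sequence of positive reals: either finite with `n + 1` terms, or bi-infinite. -/
inductive PosSeq : Type
  | finite (n : ℕ) (γ : Fin (n + 1) → ℝ) (pos : ∀ k, 0 < γ k) : PosSeq
  | biinfinite (γ : ℤ → ℝ) (pos : ∀ k, 0 < γ k) : PosSeq

namespace PosSeq

/-- The index set of the sequence. -/
def Index : PosSeq → Type
  | finite n _ _ => Fin (n + 1)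
  | biinfinite _ _ => ℤ

instance (s : PosSeq) : MeasurableSpace s.Index := ⊤

/-- The terms of the sequence. -/
def term : (s : PosSeq) → s.Index → ℝ
  | finite _ γ _ => γ
  | biinfinite γ _ => γ

/-- The map `k ↦ k + 1` on the indices; it is cyclic for a finite sequence (addition in
`Fin (n + 1)` is modulo `n + 1`, so the last index is sent to the first one). -/
def next : (s : PosSeq) → s.Index → s.Index
  | finite n _ _ => fun k : Fin (n + 1) => k + 1
  | biinfinite _ _ => fun k : ℤ => k + 1

/-- A finite sequence is geometric if it is constant; a bi-infinite one if it has a common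
ratio. -/
def IsGeometric : PosSeq → Prop
  | finite _ γ _ => ∃ c : ℝ, ∀ k, γ k = c
  | biinfinite γ _ => ∃ q : ℝ, ∀ k, γ (k + 1) = q * γ k

/-- The measure on all subsets of the index set with mass `γ k` at the point `k`. -/
def measure (s : PosSeq) : Measure s.Index :=
  Measure.sum fun k => ENNReal.ofReal (s.term k) • Measure.dirac k

theorem term_pos (s : PosSeq) (k : s.Index) : 0 < s.term k := by
  cases s with
  | finite n γ pos => exact pos k
  | biinfinite γ pos => exact pos k

theorem quasiMeasurePreserving_next (s : PosSeq) :
    Measure.QuasiMeasurePreserving s.next s.measure s.measure := by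
  refine ⟨measurable_from_top, fun t ht => ?_⟩
  have hempty : t = ∅ := by
    rw [Set.eq_empty_iff_forall_notMem]
    intro k hk
    rw [measure, Measure.sum_apply _ MeasurableSpace.measurableSet_top,
      ENNReal.tsum_eq_zero] at ht
    have h := ht k
    rw [Measure.smul_apply, Measure.dirac_apply_of_mem hk, smul_eq_mul, mul_one,
      ENNReal.ofReal_eq_zero] at h
    exact absurd (s.term_pos k) (not_lt.mpr h)
  rw [hempty, measure_empty]

/-- The two-sided backward shift in `ℓ²(γ)`: `(S f) k = f (k + 1)`, so that it sends the
characteristic function of `{k + 1}` to that of `{k}`, with domain the set of all `f ∈ ℓ²(γ)` with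
`∑ k, |f (k + 1)| ^ 2 * γ k < ∞`. -/
def shift (s : PosSeq) : Lp ℂ 2 s.measure →ₗ.[ℂ] Lp ℂ 2 s.measure :=
  compOp s.measure s.next s.quasiMeasurePreserving_next

end PosSeq

end

noncomputable section

/-! Everything is read off graphs and atoms. Off null points, `(f, g)` lies in the graph of `C_φ`
exactly when `g = f ∘ φ`. If `C_φ` is normal, comparing `C*C` and `CC*` on the characteristic
function of an atom (`compOp_isNormalOp_apply`) shows that `φ` permutes the atoms and that the ratio
of successive masses is constant along each orbit (`exists_perm_of_compOp_isNormalOp`). Each orbit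
is then a cycle or a copy of ℤ carrying a geometric sequence (`exists_isGeometric_orbit`), and
splitting `L²(μ)` along orbits turns `C_φ` into a sum of shifts. One representative per orbit gives
`J`. Conversely, the shift of a geometric sequence is a real scalar times a unitary. A sum of such
operators is normal even when the scalars are unbounded, and normality passes through unitary
equivalence. -/

theorem Memℓp.of_norm_eq {ι : Type*} {G : ι → Type*} [∀ i, NormedAddCommGroup (G i)] {f : lp G 2}
    {g : ∀ i, G i} (h : ∀ i, ‖g i‖ = ‖f i‖) :
    Memℓp g 2 := by
  have hf := lp.memℓp f
  rw [memℓp_gen_iff (by norm_num)] at hf ⊢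
  simpa only [h] using hf

namespace LinearPMap

/-! ### Products, adjoints and unitary equivalence via graphs -/

section Graph

variable {H K L : Type*} [NormedAddCommGroup H] [InnerProductSpace ℂ H]
  [NormedAddCommGroup K] [InnerProductSpace ℂ K] [NormedAddCommGroup L] [InnerProductSpace ℂ L]

theorem mem_graph_prodOp_iff {B : K →ₗ.[ℂ] L} {A : H →ₗ.[ℂ] K} {x : H} {z : L} :
    (x, z) ∈ (B.prodOp A).graph ↔ ∃ y, (x, y) ∈ A.graph ∧ (y, z) ∈ B.graph := by
  simp only [mem_graph_iff]
  constructor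
  · rintro ⟨⟨_, hx, hy⟩, rfl, rfl⟩
    exact ⟨A ⟨_, hx⟩, ⟨⟨_, hx⟩, rfl, rfl⟩, ⟨_, hy⟩, rfl, rfl⟩
  · rintro ⟨_, ⟨⟨x, hx⟩, rfl, rfl⟩, ⟨y, hy⟩, hxy, rfl⟩
    obtain rfl : y = A ⟨x, hx⟩ := hxy
    exact ⟨⟨x, hx, hy⟩, rfl, rfl⟩

theorem mem_graph_adjoint_iff [CompleteSpace H] {A : H →ₗ.[ℂ] K}
    (hA : Dense (A.domain : Set H)) {x : K} {y : H} :
    (x, y) ∈ A.adjoint.graph ↔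
      ∀ a b, (a, b) ∈ A.graph → inner ℂ y a = inner ℂ x b := by
  constructor
  · intro h a b hab
    obtain ⟨x, rfl, rfl⟩ := A.adjoint.mem_graph_iff.1 h
    obtain ⟨a, rfl, rfl⟩ := A.mem_graph_iff.1 hab
    exact adjoint_isFormalAdjoint hA x a
  · intro h
    have h' : ∀ a : A.domain, inner ℂ y (a : H) = inner ℂ x (A a) :=
      fun a => h _ _ (A.mem_graph a)
    exact A.adjoint.mem_graph_iff.2
      ⟨⟨x, mem_adjoint_domain_of_exists x ⟨y, h'⟩⟩, rfl, adjoint_apply_eq hA _ h'⟩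

theorem unitarilyEquiv_iff_graph {A : H →ₗ.[ℂ] H} {B : K →ₗ.[ℂ] K} :
    A.UnitarilyEquiv B ↔
      ∃ U : H ≃ₗᵢ[ℂ] K, ∀ x y, (x, y) ∈ A.graph ↔ (U x, U y) ∈ B.graph := by
  refine exists_congr fun U => ⟨fun ⟨hd, hv⟩ x y => ?_, fun h => ⟨fun f => ?_, fun f g hfg => ?_⟩⟩
  · simp only [mem_graph_iff]
    constructor
    · rintro ⟨x, rfl, rfl⟩
      exact ⟨⟨U x, (hd _).1 x.2⟩, rfl, (hv x _ rfl).symm⟩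
    · rintro ⟨g, hg, hy⟩
      have hx : x ∈ A.domain := (hd _).2 (hg ▸ g.2)
      exact ⟨⟨x, hx⟩, rfl, U.injective ((hv ⟨x, hx⟩ g hg).trans hy)⟩
  · simp only [mem_domain_iff]
    exact ⟨fun ⟨y, hy⟩ => ⟨U y, (h _ _).1 hy⟩, fun ⟨y, hy⟩ =>
      ⟨U.symm y, (h _ _).2 (by simpa using hy)⟩⟩
  · exact B.mem_graph_snd_inj ((h _ _).1 (A.mem_graph f)) (B.mem_graph g) hfg.symm

/-- Normality is invariant under unitary equivalence. -/
theorem IsNormalOp.of_unitarilyEquiv [CompleteSpace H] [CompleteSpace K]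
    {A : H →ₗ.[ℂ] H} {B : K →ₗ.[ℂ] K} (hB : B.IsNormalOp) (h : A.UnitarilyEquiv B) :
    A.IsNormalOp := by
  obtain ⟨U, hU⟩ := unitarilyEquiv_iff_graph.1 h
  obtain ⟨hc, hd, hn⟩ := hB
  have hdom : (A.domain : Set H) = U ⁻¹' B.domain := by
    ext x
    simp only [SetLike.mem_coe, Set.mem_preimage, mem_domain_iff]
    exact ⟨fun ⟨y, hy⟩ => ⟨U y, (hU _ _).1 hy⟩, fun ⟨y, hy⟩ =>
      ⟨U.symm y, (hU _ _).2 (by simpa using hy)⟩⟩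
  have hdA : Dense (A.domain : Set H) := by
    rw [hdom]
    exact hd.preimage U.toHomeomorph.isOpenMap
  have hadj : ∀ x y, (x, y) ∈ A.adjoint.graph ↔ (U x, U y) ∈ B.adjoint.graph := by
    intro x y
    rw [mem_graph_adjoint_iff hdA, mem_graph_adjoint_iff hd]
    constructor
    · intro hxy a b hab
      have := hxy (U.symm a) (U.symm b) ((hU _ _).2 (by simpa using hab))
      rw [← U.inner_map_map, ← U.inner_map_map x] at this
      simpa using this
    · intro hxy a b hab
      rw [← U.inner_map_map, ← U.inner_map_map x]
      exact hxy _ _ ((hU _ _).1 hab)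
  have hprod : ∀ (S T : H →ₗ.[ℂ] H) (S' T' : K →ₗ.[ℂ] K),
      (∀ x y, (x, y) ∈ S.graph ↔ (U x, U y) ∈ S'.graph) →
      (∀ x y, (x, y) ∈ T.graph ↔ (U x, U y) ∈ T'.graph) →
      ∀ x y, (x, y) ∈ (S.prodOp T).graph ↔ (U x, U y) ∈ (S'.prodOp T').graph := by
    intro S T S' T' hS hT x y
    rw [mem_graph_prodOp_iff, mem_graph_prodOp_iff, U.surjective.exists]
    exact exists_congr fun z => and_congr (hT _ _) (hS _ _)
  refine ⟨?_, hdA, eq_of_eq_graph (SetLike.ext ?_)⟩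
  · have : (A.graph : Set (H × H)) = (Prod.map U U) ⁻¹' B.graph := by
      ext ⟨x, y⟩
      exact hU x y
    rw [LinearPMap.IsClosed, this]
    exact hc.preimage (U.continuous.prodMap U.continuous)
  · rintro ⟨x, y⟩
    rw [hprod _ _ _ _ hadj hU, hprod _ _ _ _ hU hadj, hn]

end Graph

/-! ### Orthogonal sums and their normality -/

section OrthogonalSum

variable {ι : Type*} {G : ι → Type*} [∀ i, NormedAddCommGroup (G i)]
  [∀ i, InnerProductSpace ℂ (G i)]

/-- The square-summability in the domain costs nothing here: `g` already lies in the Hilbert sum. -/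
theorem mem_graph_orthogonalSum_iff {T : ∀ i, G i →ₗ.[ℂ] G i} {f g : lp G 2} :
    (f, g) ∈ (orthogonalSum T).graph ↔ ∀ i, (f i, g i) ∈ (T i).graph := by
  constructor
  · intro h i
    obtain ⟨f, rfl, rfl⟩ := (mem_graph_iff _).1 h
    exact (T i).mem_graph ⟨f.1 i, f.2.1 i⟩
  · intro h
    have hf : ∀ i, f i ∈ (T i).domain := fun i => mem_domain_of_mem_graph (h i)
    have hg : (fun i => T i ⟨f i, hf i⟩) = g :=
      funext fun i => (T i).mem_graph_snd_inj ((T i).mem_graph _) (h i) rfl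
    refine (mem_graph_iff _).2 ⟨⟨f, hf, hg ▸ g.2⟩, rfl, lp.ext hg⟩

theorem single_mem_graph_orthogonalSum [DecidableEq ι]
    {T : ∀ i, G i →ₗ.[ℂ] G i} {i : ι} {a b : G i}
    (h : (a, b) ∈ (T i).graph) :
    (lp.single 2 i a, lp.single 2 i b) ∈ (orthogonalSum T).graph := by
  rw [mem_graph_orthogonalSum_iff]
  intro j
  by_cases hj : j = i
  · subst hj
    simpa using h
  · simp only [lp.coeFn_single, Pi.single_eq_of_ne hj]
    exact (T j).graph.zero_mem

/-- An orthogonal sum of scalar multiples of unitaries is normal. -/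
theorem isNormalOp_orthogonalSum_of_smul_unitary [∀ i, CompleteSpace (G i)]
    {T : ∀ i, G i →ₗ.[ℂ] G i} (c : ι → ℝ) (V : ∀ i, G i ≃ₗᵢ[ℂ] G i)
    (hT : ∀ i x y, (x, y) ∈ (T i).graph ↔ y = (c i : ℂ) • V i x) :
    (orthogonalSum T).IsNormalOp := by
  classical
  have hgr : ∀ f g : lp G 2, (f, g) ∈ (orthogonalSum T).graph ↔
      ∀ i, g i = (c i : ℂ) • V i (f i) := fun f g => by
    simp only [mem_graph_orthogonalSum_iff, hT]
  have hsingle : ∀ i (a : G i), (lp.single 2 i a, lp.single 2 i ((c i : ℂ) • V i a)) ∈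
      (orthogonalSum T).graph := fun i a =>
    single_mem_graph_orthogonalSum ((hT i _ _).2 rfl)
  have hd : Dense ((orthogonalSum T).domain : Set (lp G 2)) := by
    rw [Submodule.dense_iff_topologicalClosure_eq_top, Submodule.topologicalClosure_eq_top_iff,
      Submodule.eq_bot_iff]
    intro f hf
    refine lp.ext (funext fun i => ?_)
    have := (Submodule.mem_orthogonal _ _).1 hf _ (mem_domain_of_mem_graph (hsingle i (f i)))
    rw [lp.inner_single_left] at this
    exact inner_self_eq_zero.1 this
  -- The adjoint acts as `c i • (V i)⁻¹` in each coordinate, stated with the inverse cleared.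
  have hadj : ∀ f g : lp G 2, (f, g) ∈ (orthogonalSum T).adjoint.graph ↔
      ∀ i, V i (g i) = (c i : ℂ) • f i := by
    intro f g
    rw [mem_graph_adjoint_iff hd]
    constructor
    · intro h i
      refine ext_inner_right ℂ fun v => ?_
      obtain ⟨a, rfl⟩ := (V i).surjective v
      have := h _ _ (hsingle i a)
      rw [← inner_conj_symm, lp.inner_single_left, inner_conj_symm, ← inner_conj_symm f,
        lp.inner_single_left, inner_conj_symm, inner_smul_right] at this
      rw [(V i).inner_map_map, this, inner_smul_left, Complex.conj_ofReal]
    · intro h a b hab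
      rw [hgr] at hab
      rw [lp.inner_eq_tsum, lp.inner_eq_tsum]
      refine tsum_congr fun i => ?_
      rw [hab, ← (V i).inner_map_map, h, inner_smul_left, inner_smul_right, Complex.conj_ofReal]
  have hV : ∀ i a, V i ((c i : ℂ) • a) = (c i : ℂ) • V i a := fun i a => (V i).map_smul _ a
  refine ⟨?_, hd, eq_of_eq_graph (SetLike.ext ?_)⟩
  · have : ((orthogonalSum T).graph : Set (lp G 2 × lp G 2)) =
        ⋂ i, {p | p.2 i = (c i : ℂ) • V i (p.1 i)} := by
      ext ⟨f, g⟩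
      simpa using hgr f g
    rw [LinearPMap.IsClosed, this]
    have hev : ∀ i, Continuous fun f : lp G 2 => f i :=
      fun i => (lp.lipschitzWith_one_eval 2 i).continuous
    exact isClosed_iInter fun i => isClosed_eq ((hev i).comp continuous_snd)
      (((V i).continuous.comp ((hev i).comp continuous_fst)).const_smul _)
  -- Both products multiply coordinate `i` by `(c i)²`. Their intermediate vectors, `c i • V i (f
  -- i)` and `c i • (V i)⁻¹ (f i)`, have equal norms in each coordinate, so one is square-summable
  -- iff the other is; this gives equal domains.
  · rintro ⟨f, g⟩
    simp only [mem_graph_prodOp_iff, hgr, hadj]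
    constructor
    · rintro ⟨y, hy, hg⟩
      have hz : ∀ i, ‖(c i : ℂ) • (V i).symm (f i)‖ = ‖y i‖ := fun i => by
        rw [hy, norm_smul, norm_smul, LinearIsometryEquiv.norm_map, LinearIsometryEquiv.norm_map]
      refine ⟨⟨_, Memℓp.of_norm_eq hz⟩, fun i => by simp only [hV, LinearIsometryEquiv.apply_symm_apply],
        fun i => (V i).injective ?_⟩
      simp only [hg, hy, hV, LinearIsometryEquiv.apply_symm_apply]
    · rintro ⟨y, hy, hg⟩
      have hz : ∀ i, ‖(c i : ℂ) • V i (f i)‖ = ‖y i‖ := fun i => by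
        rw [← (V i).norm_map (y i), hy, norm_smul, norm_smul, LinearIsometryEquiv.norm_map]
      refine ⟨⟨_, Memℓp.of_norm_eq hz⟩, fun i => rfl, fun i => ?_⟩
      simp only [hg, hy, hV]

end OrthogonalSum

end LinearPMap

/-! ### L² functions and composition operators on a countable space -/

theorem MeasureTheory.L2.ext_of_atoms {α : Type*} [Countable α] [MeasurableSpace α] {μ : Measure α}
    {f g : Lp ℂ 2 μ} (h : ∀ x, μ {x} ≠ 0 → f x = g x) : f = g :=
  Lp.ext (ae_iff_of_countable.2 h)

theorem MeasureTheory.MemLp.coeFn_toLp_of_atom {α : Type*} [Countable α] [MeasurableSpace α]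
    {μ : Measure α} {f : α → ℂ} (hf : MemLp f 2 μ) {x : α} (hx : μ {x} ≠ 0) :
    hf.toLp f x = f x :=
  ae_iff_of_countable.1 hf.coeFn_toLp x hx

/-- The domain condition is absorbed: `f ∘ φ` agrees almost everywhere with `g`, which is in L². -/
theorem mem_graph_compOp_iff {α : Type*} [Countable α] [MeasurableSpace α]
    {μ : Measure α} {φ : α → α} {hφ : Measure.QuasiMeasurePreserving φ μ μ}
    {f g : Lp ℂ 2 μ} :
    (f, g) ∈ (compOp μ φ hφ).graph ↔ ∀ x, μ {x} ≠ 0 → g x = f (φ x) := by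
  constructor
  · intro h x hx
    obtain ⟨f, rfl, rfl⟩ := (LinearPMap.mem_graph_iff _).1 h
    exact MemLp.coeFn_toLp_of_atom f.2 hx
  · intro h
    have hf : MemLp (f ∘ φ) 2 μ := (Lp.memLp g).ae_eq (ae_iff_of_countable.2 h)
    exact (LinearPMap.mem_graph_iff _).2
      ⟨⟨f, hf⟩, rfl, L2.ext_of_atoms fun x hx => (MemLp.coeFn_toLp_of_atom hf hx).trans (h x hx).symm⟩

section Discrete

variable {α : Type*} [Countable α] [MeasurableSpace α] [DiscreteMeasurableSpace α]
  {μ : Measure α}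

theorem MeasureTheory.memLp_two_iff_summable (hμ : ∀ x, μ {x} ≠ ∞) {f : α → ℂ} :
    MemLp f 2 μ ↔ Summable fun x => μ.real {x} * ‖f x‖ ^ 2 := by
  rw [memLp_two_iff_integrable_sq_norm (measurable_of_countable f).aestronglyMeasurable]
  have hm : AEStronglyMeasurable (fun x => ‖f x‖ ^ 2) μ :=
    (measurable_of_countable _).aestronglyMeasurable
  have h : ∀ x, ‖‖f x‖ ^ 2‖ₑ * μ {x} = ENNReal.ofReal (μ.real {x} * ‖f x‖ ^ 2) := fun x => by
    rw [Real.enorm_of_nonneg (by positivity), mul_comm (μ.real _),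
      ENNReal.ofReal_mul (by positivity), Measure.real, ENNReal.ofReal_toReal (hμ x)]
  rw [Integrable, and_iff_right hm, HasFiniteIntegral, lintegral_countable']
  simp only [h]
  constructor
  · intro hs
    have := ENNReal.summable_toReal hs.ne
    refine this.congr fun x => ENNReal.toReal_ofReal (by positivity)
  · intro hs
    exact hs.tsum_ofReal_lt_top

theorem MeasureTheory.L2.hasSum_norm_sq (hμ : ∀ x, μ {x} ≠ ∞) (f : Lp ℂ 2 μ) :
    HasSum (fun x => μ.real {x} * ‖f x‖ ^ 2) (‖f‖ ^ 2) := by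
  have hs := (memLp_two_iff_summable hμ).1 (Lp.memLp f)
  have hi := (memLp_two_iff_integrable_sq_norm (Lp.aestronglyMeasurable f)).1 (Lp.memLp f)
  have h : ‖f‖ ^ 2 = ∑' x, μ.real {x} * ‖f x‖ ^ 2 := by
    have h1 : ((‖f‖ ^ 2 : ℝ) : ℂ) = ((∫ x, ‖f x‖ ^ 2 ∂μ : ℝ) : ℂ) := by
      rw [← integral_complex_ofReal]
      push_cast
      rw [show (‖f‖ : ℂ) ^ 2 = inner ℂ f f from (inner_self_eq_norm_sq_to_K f).symm, L2.inner_def]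
      exact integral_congr_ae (ae_of_all _ fun x => by simp [inner_self_eq_norm_sq_to_K])
    rw [Complex.ofReal_injective h1, integral_countable hi]
    rfl
  rw [h]
  exact hs.hasSum

end Discrete

theorem MeasureTheory.Measure.QuasiMeasurePreserving.measure_singleton_ne_zero {X : Type*}
    [MeasurableSpace X] {μ : Measure X} {φ : X → X}
    (hφ : Measure.QuasiMeasurePreserving φ μ μ) {x : X} (hx : μ {x} ≠ 0) : μ {φ x} ≠ 0 :=
  fun h => hx (measure_mono_null (by simp) (hφ.preimage_null h))

/-! ### Consequences of normality for `φ` and `μ` -/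

section Normal

variable {X : Type*} [Countable X] [MeasurableSpace X] [DiscreteMeasurableSpace X]
  {μ : Measure X} {φ : X → X} {hφ : Measure.QuasiMeasurePreserving φ μ μ}

/-- The inner product of the characteristic function of `{x}` with `f` is `μ {x} * f x`. -/
theorem inner_indicator_singleton {x : X} (hx : μ {x} ≠ ∞) (f : Lp ℂ 2 μ) :
    inner ℂ (indicatorConstLp 2 (.of_discrete : MeasurableSet {x}) hx (1 : ℂ)) f =
      μ.real {x} * f x := by
  rw [L2.inner_indicatorConstLp_one, integral_singleton]
  simp

theorem indicatorConstLp_apply_of_atom {s : Set X} (hs : μ s ≠ ∞) {x : X} (hx : μ {x} ≠ 0) :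
    indicatorConstLp 2 (.of_discrete : MeasurableSet s) hs (1 : ℂ) x =
      s.indicator (fun _ => 1) x :=
  ae_iff_of_countable.1 indicatorConstLp_coeFn x hx

/-- By density some `f` in the domain has `f x ≠ 0`. On the fibre over `x`, `f ∘ φ` is a nonzero
constant, and it is in L², so the fibre has finite mass. -/
theorem compOp_measure_preimage_ne_top (hμ : ∀ x, μ {x} ≠ ∞)
    (hd : Dense ((compOp μ φ hφ).domain : Set (Lp ℂ 2 μ))) {x : X} (hx : μ {x} ≠ 0) :
    μ (φ ⁻¹' {x}) ≠ ∞ := by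
  obtain ⟨f, hf, hfx⟩ : ∃ f ∈ (compOp μ φ hφ).domain, f x ≠ 0 := by
    by_contra! h
    set e := indicatorConstLp 2 (.of_discrete : MeasurableSet {x}) (hμ x) (1 : ℂ)
    have he : e = 0 := hd.eq_zero_of_inner_left ℂ fun v hv => by
      rw [inner_indicator_singleton, h v hv, mul_zero]
    have h1 : e x = 1 := by rw [indicatorConstLp_apply_of_atom (hμ x) hx]; simp
    rw [he, ae_iff_of_countable.1 (Lp.coeFn_zero ℂ 2 μ) x hx] at h1
    simp at h1
  have hf' : MemLp (f ∘ φ) 2 μ := hf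
  refine ((measure_mono ?_).trans_lt (hf'.meas_ge_lt_top two_ne_zero ENNReal.ofNat_ne_top
    (ε := ‖f x‖₊) (by simpa using hfx))).ne
  intro y hy
  simp only [Set.mem_preimage, Set.mem_singleton_iff] at hy
  simp [hy]

/-- The pointwise content of `C* C χ_{x} = C C* χ_{x}` for a composition operator `C`. -/
theorem compOp_isNormalOp_apply (hμ : ∀ x, μ {x} ≠ ∞) (hn : (compOp μ φ hφ).IsNormalOp) {x : X}
    (hx : μ {x} ≠ 0) {y : X} (hy : μ {y} ≠ 0) :
    μ.real (φ ⁻¹' {x}) / μ.real {x} * ({x} : Set X).indicator (fun _ => 1) y =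
      μ.real {x} / μ.real {φ x} * ({φ x} : Set X).indicator (fun _ => 1) (φ y) := by
  obtain ⟨-, hd, hn⟩ := hn
  have hm0 : ∀ {x}, μ {x} ≠ 0 → (μ.real {x} : ℂ) ≠ 0 := fun h => by
    simpa [Measure.real, ENNReal.toReal_eq_zero_iff, hμ] using h
  have hp := compOp_measure_preimage_ne_top hμ hd hx
  have hφx := hφ.measure_singleton_ne_zero hx
  set e := fun x => indicatorConstLp 2 (.of_discrete : MeasurableSet {x}) (hμ x) (1 : ℂ) with he
  set u := indicatorConstLp 2 (.of_discrete : MeasurableSet (φ ⁻¹' {x})) hp (1 : ℂ) with hu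
  -- With `e x` the characteristic function of `{x}`: `u = C (e x)`, `w = C* u` and `v = C* (e x)`.
  -- Normality forces `w = C v`.
  set w := ((μ.real (φ ⁻¹' {x}) / μ.real {x} : ℝ) : ℂ) • e x with hw
  set v := ((μ.real {x} / μ.real {φ x} : ℝ) : ℂ) • e (φ x) with hv
  have h1 : (e x, u) ∈ (compOp μ φ hφ).graph := mem_graph_compOp_iff.2 fun y hy => by
    rw [indicatorConstLp_apply_of_atom _ hy,
      indicatorConstLp_apply_of_atom _ (hφ.measure_singleton_ne_zero hy)]
    rfl
  have h2 : (u, w) ∈ (compOp μ φ hφ).adjoint.graph := by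
    rw [LinearPMap.mem_graph_adjoint_iff hd]
    intro f g hfg
    rw [mem_graph_compOp_iff] at hfg
    rw [hw, hu, inner_smul_left, inner_indicator_singleton, L2.inner_indicatorConstLp_one,
      setIntegral_congr_ae (g := fun _ => f x) .of_discrete
        (ae_iff_of_countable.2 fun y hy hyx => by rw [hfg y hy]; congr 1)]
    have := hm0 hx
    simp only [Complex.conj_ofReal, setIntegral_const, Complex.real_smul]
    push_cast
    field_simp
  have h3 : (e x, v) ∈ (compOp μ φ hφ).adjoint.graph := by
    rw [LinearPMap.mem_graph_adjoint_iff hd]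
    intro f g hfg
    rw [mem_graph_compOp_iff] at hfg
    rw [hv, inner_smul_left, inner_indicator_singleton, inner_indicator_singleton, hfg x hx]
    have := hm0 hφx
    simp only [Complex.conj_ofReal]
    push_cast
    field_simp
  have h4 : (e x, w) ∈ ((compOp μ φ hφ).adjoint.prodOp (compOp μ φ hφ)).graph :=
    LinearPMap.mem_graph_prodOp_iff.2 ⟨u, h1, h2⟩
  rw [hn, LinearPMap.mem_graph_prodOp_iff] at h4
  obtain ⟨v', hv', h5⟩ := h4
  rw [LinearPMap.mem_graph_snd_inj _ hv' h3 rfl, mem_graph_compOp_iff] at h5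
  have h6 := h5 y hy
  rw [hw, hv, ae_iff_of_countable.1 (Lp.coeFn_smul _ _) y hy,
    ae_iff_of_countable.1 (Lp.coeFn_smul _ _) _ (hφ.measure_singleton_ne_zero hy),
    Pi.smul_apply, Pi.smul_apply, indicatorConstLp_apply_of_atom _ hy,
    indicatorConstLp_apply_of_atom _ (hφ.measure_singleton_ne_zero hy)] at h6
  apply Complex.ofReal_injective
  simp only [smul_eq_mul] at h6
  push_cast at h6 ⊢
  convert h6 using 2
  · by_cases h : y = x <;> simp [h]
  · by_cases h : φ y = φ x <;> simp [h]

/-- A normal composition operator is induced by a map which permutes the atoms of the measure,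
with masses in geometric progression along the orbits. -/
theorem exists_perm_of_compOp_isNormalOp (hμ : ∀ x, μ {x} ≠ ∞)
    (hn : (compOp μ φ hφ).IsNormalOp) :
    ∃ σ : Equiv.Perm {x // μ {x} ≠ 0}, (∀ x, (σ x : X) = φ x) ∧
      ∀ x, μ.real {(σ (σ x) : X)} / μ.real {(σ x : X)} = μ.real {(σ x : X)} / μ.real {(x : X)} := by
  have hpos : ∀ {x}, μ {x} ≠ 0 → 0 < μ.real {x} := fun h =>
    ENNReal.toReal_pos h (hμ _)
  set ψ : {x // μ {x} ≠ 0} → {x // μ {x} ≠ 0} :=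
    fun x => ⟨φ x, hφ.measure_singleton_ne_zero x.2⟩ with hψ
  -- The diagonal case `y = x`.
  have key : ∀ x, μ {x} ≠ 0 →
      μ.real (φ ⁻¹' {x}) / μ.real {x} = μ.real {x} / μ.real {φ x} := fun x hx => by
    simpa using compOp_isNormalOp_apply hμ hn hx hx
  have hinj : Function.Injective ψ := by
    rintro ⟨y, hy⟩ ⟨x, hx⟩ hxy
    have hxy' : φ y = φ x := congrArg Subtype.val hxy
    -- If `y ≠ x` but `φ y = φ x`, the left side is zero and the right side is positive.
    have h := compOp_isNormalOp_apply hμ hn hx hy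
    by_contra hne
    have hne' : y ≠ x := fun h => hne (Subtype.ext h)
    have h1 := hpos hx
    have h2 := hpos (hφ.measure_singleton_ne_zero hx)
    simp [hne', hxy'] at h
    exact (div_pos h1 h2).ne h
  have hsurj : Function.Surjective ψ := by
    rintro ⟨x, hx⟩
    have h1 := hpos hx
    have h2 := hpos (hφ.measure_singleton_ne_zero hx)
    -- By `key` the fibre over an atom has positive mass, so it must contain an atom.
    have h3 : μ (φ ⁻¹' {x}) ≠ 0 := fun h0 => by
      have := key x hx
      rw [Measure.real, h0] at this
      have : 0 < μ.real {x} / μ.real {φ x} := by positivity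
      simp_all
    by_contra! hno
    refine h3 (measure_mono_null (t := {y | ¬ φ y ≠ x}) (fun y hy => not_not.2 hy) ?_)
    exact ae_iff.1 (ae_iff_of_countable.2 fun y hy hyx => hno ⟨y, hy⟩ (Subtype.ext hyx))
  refine ⟨Equiv.ofBijective ψ ⟨hinj, hsurj⟩, fun x => rfl, fun ⟨x, hx⟩ => ?_⟩
  change μ.real {φ (φ x)} / μ.real {φ x} = μ.real {φ x} / μ.real {x}
  have h1 := hφ.measure_singleton_ne_zero hx
  -- By injectivity the fibre over `φ x` is `{x}` up to a null set, so `key` at `φ x` compares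
  -- successive ratios.
  have h2 : μ.real (φ ⁻¹' {φ x}) = μ.real {x} := by
    refine measureReal_congr (ae_iff_of_countable.2 fun y hy => propext ⟨fun h => ?_, fun h => ?_⟩)
    · exact congrArg Subtype.val (@hinj ⟨y, hy⟩ ⟨x, hx⟩ (Subtype.ext h))
    · exact congrArg φ h
  have h3 := key _ h1
  rw [h2] at h3
  rw [← inv_div, ← h3, inv_div]

end Normal

/-! ### Unitaries from reindexing atoms -/

section Unitaries

theorem MeasureTheory.L2.exists_unitary_comp_equiv {α : Type*} [Countable α] [MeasurableSpace α]
    [DiscreteMeasurableSpace α] {μ : Measure α} (h0 : ∀ k, μ {k} ≠ 0) (hμ : ∀ k, μ {k} ≠ ∞)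
    (e : α ≃ α) {q : ℝ} (hq : 0 < q) (he : ∀ k, μ.real {e k} = q * μ.real {k}) :
    ∃ V : Lp ℂ 2 μ ≃ₗᵢ[ℂ] Lp ℂ 2 μ, ∀ f k, V f k = (√q : ℂ) * f (e k) := by
  -- The factor `√q` compensates exactly for the change of mass under `e`.
  have hterm : ∀ (f : α → ℂ) k, μ.real {k} * ‖(√q : ℂ) * f (e k)‖ ^ 2 =
      μ.real {e k} * ‖f (e k)‖ ^ 2 := fun f k => by
    rw [he, norm_mul, Complex.norm_real, Real.norm_eq_abs, mul_pow, sq_abs, Real.sq_sqrt hq.le]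
    ring
  have hsq : (√q : ℂ) ≠ 0 := by exact_mod_cast (Real.sqrt_pos.2 hq).ne'
  have hmem : ∀ f : Lp ℂ 2 μ, MemLp (fun k => (√q : ℂ) * f (e k)) 2 μ := fun f => by
    rw [memLp_two_iff_summable hμ]
    simp only [hterm f]
    exact (e.summable_iff (f := fun k => μ.real {k} * ‖f k‖ ^ 2)).2
      (L2.hasSum_norm_sq hμ f).summable
  let V : Lp ℂ 2 μ →ₗᵢ[ℂ] Lp ℂ 2 μ :=
    { toFun := fun f => (hmem f).toLp
      map_add' := fun f g => L2.ext_of_atoms fun k hk => by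
        rw [ae_iff_of_countable.1 (Lp.coeFn_add _ _) k hk, Pi.add_apply]
        simp only [MemLp.coeFn_toLp_of_atom _ hk,
          ae_iff_of_countable.1 (Lp.coeFn_add f g) _ (h0 _), Pi.add_apply, mul_add]
      map_smul' := fun c f => L2.ext_of_atoms fun k hk => by
        rw [RingHom.id_apply, ae_iff_of_countable.1 (Lp.coeFn_smul _ _) k hk, Pi.smul_apply]
        simp only [MemLp.coeFn_toLp_of_atom _ hk,
          ae_iff_of_countable.1 (Lp.coeFn_smul c f) _ (h0 _), Pi.smul_apply, smul_eq_mul]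
        ring
      norm_map' := fun f => by
        refine (sq_eq_sq₀ (norm_nonneg _) (norm_nonneg _)).1 ?_
        refine HasSum.unique (L2.hasSum_norm_sq hμ (hmem f).toLp) ?_
        simp only [MemLp.coeFn_toLp_of_atom _ (h0 _), hterm f]
        exact (e.hasSum_iff (f := fun k => μ.real {k} * ‖f k‖ ^ 2)).2 (L2.hasSum_norm_sq hμ f) }
  have hV : ∀ f k, V f k = (√q : ℂ) * f (e k) := fun f k =>
    MemLp.coeFn_toLp_of_atom (hmem f) (h0 k)
  refine ⟨LinearIsometryEquiv.ofSurjective V fun g => ?_, hV⟩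
  have hg : MemLp (fun k => (√q : ℂ)⁻¹ * g (e.symm k)) 2 μ := by
    rw [memLp_two_iff_summable hμ, ← e.summable_iff]
    refine (L2.hasSum_norm_sq hμ g).summable.congr fun k => ?_
    rw [Function.comp_apply, ← hterm (fun k => (√q : ℂ)⁻¹ * g (e.symm k)), Equiv.symm_apply_apply,
      mul_inv_cancel_left₀ hsq]
  refine ⟨hg.toLp, L2.ext_of_atoms fun k _ => ?_⟩
  rw [hV, MemLp.coeFn_toLp_of_atom hg (h0 _), Equiv.symm_apply_apply, mul_inv_cancel_left₀ hsq]

/-- A partition of the atoms of `μ` splits `L²(μ)` into a Hilbert sum. -/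
theorem MeasureTheory.L2.exists_unitary_lp {X ι : Type*} [Countable X] [MeasurableSpace X]
    [DiscreteMeasurableSpace X] {μ : Measure X} (hμ : ∀ x, μ {x} ≠ ∞)
    {α : ι → Type*} [∀ i, Countable (α i)] [∀ i, MeasurableSpace (α i)]
    [∀ i, DiscreteMeasurableSpace (α i)] {ν : ∀ i, Measure (α i)}
    (h0 : ∀ i k, ν i {k} ≠ 0) (hν : ∀ i k, ν i {k} ≠ ∞)
    (e : (Σ i, α i) ≃ {x // μ {x} ≠ 0}) (he : ∀ i k, (ν i).real {k} = μ.real {(e ⟨i, k⟩ : X)}) :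
    ∃ U : Lp ℂ 2 μ ≃ₗᵢ[ℂ] lp (fun i => Lp ℂ 2 (ν i)) 2, ∀ f i k, U f i k = f (e ⟨i, k⟩) := by
  -- Null points contribute zero, so the sum over `X` becomes a sum over the pieces.
  have hsum : ∀ (f : X → ℂ) (a : ℝ), HasSum (fun x => μ.real {x} * ‖f x‖ ^ 2) a ↔
      HasSum (fun p : Σ i, α i => (ν p.1).real {p.2} * ‖f (e p)‖ ^ 2) a := fun f a => by
    rw [← hasSum_subtype_iff_of_support_subset (s := {x | μ {x} ≠ 0})]
    · simp only [he]
      exact (e.hasSum_iff (f := fun x : {x // μ {x} ≠ 0} => μ.real {(x : X)} * ‖f x‖ ^ 2)).symm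
    · intro x hx hx0
      exact hx (by simp [Measure.real, hx0])
  have hmem : ∀ (f : Lp ℂ 2 μ) i, MemLp (fun k => f (e ⟨i, k⟩)) 2 (ν i) := fun f i => by
    rw [memLp_two_iff_summable (hν i)]
    exact ((hsum f _).1 (L2.hasSum_norm_sq hμ f)).summable.sigma_factor i
  have hfib : ∀ f : Lp ℂ 2 μ, HasSum (fun i => ‖(hmem f i).toLp‖ ^ 2) (‖f‖ ^ 2) := fun f =>
    ((hsum f _).1 (L2.hasSum_norm_sq hμ f)).sigma fun i => by
      simpa only [MemLp.coeFn_toLp_of_atom _ (h0 _ _)] using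
        L2.hasSum_norm_sq (hν i) (hmem f i).toLp
  have hlp : ∀ f : Lp ℂ 2 μ, Memℓp (fun i => (hmem f i).toLp) 2 := fun f => by
    rw [memℓp_gen_iff (by norm_num)]
    simpa using (hfib f).summable
  let U : Lp ℂ 2 μ →ₗᵢ[ℂ] lp (fun i => Lp ℂ 2 (ν i)) 2 :=
    { toFun := fun f => ⟨_, hlp f⟩
      map_add' := fun f g => lp.ext <| funext fun i => L2.ext_of_atoms fun k hk => by
        rw [lp.coeFn_add, Pi.add_apply, ae_iff_of_countable.1 (Lp.coeFn_add _ _) k hk, Pi.add_apply]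
        simp only [MemLp.coeFn_toLp_of_atom _ hk,
          ae_iff_of_countable.1 (Lp.coeFn_add f g) _ (e _).2, Pi.add_apply]
      map_smul' := fun c f => lp.ext <| funext fun i => L2.ext_of_atoms fun k hk => by
        rw [RingHom.id_apply, lp.coeFn_smul, Pi.smul_apply,
          ae_iff_of_countable.1 (Lp.coeFn_smul _ _) k hk, Pi.smul_apply]
        simp only [MemLp.coeFn_toLp_of_atom _ hk,
          ae_iff_of_countable.1 (Lp.coeFn_smul c f) _ (e _).2, Pi.smul_apply]
      norm_map' := fun f => by
        refine (sq_eq_sq₀ (norm_nonneg _) (norm_nonneg _)).1 ?_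
        refine HasSum.unique ?_ (hfib f)
        simpa using lp.hasSum_norm (by norm_num)
          (⟨_, hlp f⟩ : lp (fun i => Lp ℂ 2 (ν i)) 2) }
  have hU : ∀ f i k, U f i k = f (e ⟨i, k⟩) := fun f i k =>
    MemLp.coeFn_toLp_of_atom (hmem f i) (h0 i k)
  refine ⟨LinearIsometryEquiv.ofSurjective U fun g => ?_, hU⟩
  classical
  -- The preimage of `g` glues its components over the atoms; the value at null points is
  -- irrelevant.
  let f : X → ℂ := fun x => if h : μ {x} ≠ 0 then g (e.symm ⟨x, h⟩).1 (e.symm ⟨x, h⟩).2 else 0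
  have hf : ∀ p, f (e p) = g p.1 p.2 := fun p => by
    simp only [f, dif_pos (e p).2]
    rw [Equiv.symm_apply_apply]
  have hfm : MemLp f 2 μ := by
    rw [memLp_two_iff_summable hμ]
    suffices h : Summable fun p : Σ i, α i => (ν p.1).real {p.2} * ‖f (e p)‖ ^ 2 from
      ((hsum f _).2 h.hasSum).summable
    simp only [hf]
    refine (summable_sigma_of_nonneg fun p => by positivity).2
      ⟨fun i => (L2.hasSum_norm_sq (hν i) (g i)).summable, ?_⟩
    simp only [(L2.hasSum_norm_sq (hν _) (g _)).tsum_eq]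
    simpa using (lp.hasSum_norm (by norm_num) g).summable
  refine ⟨hfm.toLp, lp.ext <| funext fun i => L2.ext_of_atoms fun k hk => ?_⟩
  rw [hU, MemLp.coeFn_toLp_of_atom hfm (e _).2, hf]

end Unitaries

/-! ### Geometric sequences, their shifts, and orbits of permutations -/

namespace PosSeq

instance (s : PosSeq) : DiscreteMeasurableSpace s.Index := ⟨fun _ => trivial⟩

instance (s : PosSeq) : Countable s.Index := by
  cases s with
  | finite n γ pos => exact inferInstanceAs (Countable (Fin (n + 1)))
  | biinfinite γ pos => exact inferInstanceAs (Countable ℤ)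

theorem measure_singleton (s : PosSeq) (k : s.Index) :
    s.measure {k} = ENNReal.ofReal (s.term k) := by
  rw [measure, Measure.sum_apply _ .of_discrete, tsum_eq_single k]
  · simp
  · intro j hj
    simp [hj]

theorem measure_singleton_ne_zero (s : PosSeq) (k : s.Index) : s.measure {k} ≠ 0 := by
  simpa [measure_singleton] using s.term_pos k

theorem measure_singleton_ne_top (s : PosSeq) (k : s.Index) : s.measure {k} ≠ ∞ := by
  simp [measure_singleton]

theorem measure_real_singleton (s : PosSeq) (k : s.Index) : s.measure.real {k} = s.term k := by
  rw [Measure.real, measure_singleton, ENNReal.toReal_ofReal (s.term_pos k).le]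

theorem next_bijective (s : PosSeq) : Function.Bijective s.next := by
  cases s with
  | finite n γ pos => exact (Equiv.addRight (1 : Fin (n + 1))).bijective
  | biinfinite γ pos => exact (Equiv.addRight (1 : ℤ)).bijective

theorem IsGeometric.exists_ratio {s : PosSeq} (hs : s.IsGeometric) :
    ∃ q : ℝ, 0 < q ∧ ∀ k, s.term (s.next k) = q * s.term k := by
  cases s with
  | finite n γ pos =>
    obtain ⟨c, hc⟩ := hs
    exact ⟨1, one_pos, fun k => by rw [one_mul]; exact (hc _).trans (hc _).symm⟩
  | biinfinite γ pos =>
    obtain ⟨q, hq⟩ := hs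
    exact ⟨q, pos_of_mul_pos_left ((hq 0).symm ▸ pos _) (pos 0).le, hq⟩

theorem mem_graph_shift_iff {s : PosSeq} {f g : Lp ℂ 2 s.measure} :
    (f, g) ∈ s.shift.graph ↔ ∀ k, g k = f (s.next k) :=
  mem_graph_compOp_iff.trans ⟨fun h k => h k (s.measure_singleton_ne_zero k), fun h k _ => h k⟩

/-- The shift of a geometric sequence is a scalar multiple of a unitary. -/
theorem IsGeometric.shift_eq_smul_unitary {s : PosSeq} (hs : s.IsGeometric) :
    ∃ (c : ℝ) (V : Lp ℂ 2 s.measure ≃ₗᵢ[ℂ] Lp ℂ 2 s.measure),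
      ∀ f g, (f, g) ∈ s.shift.graph ↔ g = (c : ℂ) • V f := by
  obtain ⟨q, hq, hterm⟩ := hs.exists_ratio
  obtain ⟨V, hV⟩ := L2.exists_unitary_comp_equiv s.measure_singleton_ne_zero
    s.measure_singleton_ne_top (Equiv.ofBijective s.next s.next_bijective) hq
    fun k => by simp only [measure_real_singleton]; exact hterm k
  have hsq : (√q : ℂ) ≠ 0 := by exact_mod_cast (Real.sqrt_pos.2 hq).ne'
  -- `V` is `√q` times the shift, hence the inverse.
  refine ⟨(√q)⁻¹, V, fun f g => ?_⟩
  have h : ∀ k, (((√q)⁻¹ : ℝ) : ℂ) • V f k = f (s.next k) := fun k => by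
    rw [hV, smul_eq_mul, Complex.ofReal_inv, inv_mul_cancel_left₀ hsq]
    rfl
  rw [mem_graph_shift_iff]
  constructor
  · intro hg
    refine L2.ext_of_atoms fun k hk => ?_
    rw [ae_iff_of_countable.1 (Lp.coeFn_smul _ _) k hk, Pi.smul_apply, h, hg]
  · rintro rfl k
    rw [ae_iff_of_countable.1 (Lp.coeFn_smul _ _) k (s.measure_singleton_ne_zero k),
      Pi.smul_apply, h]

/-- The masses along an orbit of a permutation form a geometric sequence if the ratios of
successive masses do not change. -/
theorem exists_isGeometric_orbit {Y : Type*} (σ : Equiv.Perm Y) {m : Y → ℝ} (hm : ∀ y, 0 < m y)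
    (hr : ∀ y, m (σ (σ y)) / m (σ y) = m (σ y) / m y) (y : Y) :
    ∃ s : PosSeq, s.IsGeometric ∧ ∃ o : s.Index → Y, Function.Injective o ∧
      (∀ z, σ.SameCycle y z ↔ ∃ k, o k = z) ∧ (∀ k, s.term k = m (o k)) ∧
      ∀ k, o (s.next k) = σ (o k) := by
  -- The ratio at `y` propagates along the orbit in both directions.
  have hratio : ∀ (k : ℤ), m (σ ((σ ^ k) y)) = m (σ y) / m y * m ((σ ^ k) y) := by
    intro k
    rw [← div_eq_iff (hm _).ne']
    induction k with
    | zero => rfl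
    | succ k ih => rw [← ih, ← hr ((σ ^ (k : ℤ)) y), add_comm, zpow_one_add, Equiv.Perm.mul_apply]
    | pred k ih =>
      have h : (σ ^ (-(k : ℤ))) y = σ ((σ ^ (-(k : ℤ) - 1)) y) := by
        rw [← Equiv.Perm.mul_apply, ← zpow_one_add, add_sub_cancel]
      rw [← ih, h, hr]
  by_cases hy : y ∈ Function.periodicPts σ
  · obtain ⟨n, hn⟩ : ∃ n, Function.minimalPeriod σ y = n + 1 :=
      Nat.exists_eq_succ_of_ne_zero (Function.minimalPeriod_pos_of_mem_periodicPts hy).ne'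
    have hpow : ∀ k : ℕ, m (σ^[k] y) = (m (σ y) / m y) ^ k * m y := by
      intro k
      induction k with
      | zero => simp
      | succ k ih =>
        have := hratio k
        rw [zpow_natCast, ← Equiv.Perm.iterate_eq_pow] at this
        rw [Function.iterate_succ_apply', this, ih, pow_succ]
        ring
    -- After a full period the mass returns to `m y`, so a positive ratio has `(n + 1)`-th power
    -- one.
    have hq : m (σ y) / m y = 1 := by
      have h := hpow (n + 1)
      rw [← hn, Function.iterate_minimalPeriod, hn, eq_comm, mul_eq_right₀ (hm y).ne'] at h
      exact (pow_eq_one_iff_of_nonneg (div_pos (hm _) (hm _)).le n.succ_ne_zero).1 h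
    refine ⟨finite n (fun k => m (σ^[k] y)) fun k => hm _, ⟨m y, fun k => ?_⟩,
      fun k : Fin (n + 1) => σ^[k] y, ?_, fun z => ⟨?_, ?_⟩, fun k => rfl, fun k => ?_⟩
    · simp only [hpow, hq, one_pow, one_mul]
    · intro (j : Fin (n + 1)) (k : Fin (n + 1)) hjk
      exact Fin.ext (Function.iterate_injOn_Iio_minimalPeriod (f := σ) (x := y)
        (by simp [hn, j.is_lt]) (by simp [hn, k.is_lt]) hjk)
    · rintro ⟨i, rfl⟩
      -- Reducing the exponent modulo the period lands it in `Fin (n + 1)`, negative exponents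
      -- included.
      have h := MulAction.zpow_smul_mod_minimalPeriod σ y i
      have hper : Function.minimalPeriod (fun x => σ • x) y = n + 1 := hn
      rw [hper] at h
      have hi0 : 0 ≤ i % ((n + 1 : ℕ) : ℤ) := Int.emod_nonneg _ (by positivity)
      have hi1 : i % ((n + 1 : ℕ) : ℤ) < (n + 1 : ℕ) := Int.emod_lt_of_pos _ (by positivity)
      obtain ⟨k, hk⟩ := Int.eq_ofNat_of_zero_le hi0
      rw [hk] at h hi1
      refine ⟨(⟨k, by exact_mod_cast hi1⟩ : Fin (n + 1)), ?_⟩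
      rw [zpow_natCast] at h
      simpa [Equiv.Perm.iterate_eq_pow] using h
    · rintro ⟨(k : Fin (n + 1)), rfl⟩
      exact ⟨(k : ℕ), by simp [Equiv.Perm.iterate_eq_pow]⟩
    · revert k
      intro (k : Fin (n + 1))
      change σ^[((k + 1 : Fin (n + 1)) : ℕ)] y = σ (σ^[(k : ℕ)] y)
      rw [Fin.val_add, Fin.val_one', Nat.add_mod_mod, ← Function.iterate_succ_apply' σ]
      simpa only [hn] using Function.iterate_mod_minimalPeriod_eq (f := σ) (x := y) (n := k + 1)
  · refine ⟨biinfinite (fun k => m ((σ ^ k) y)) fun k => hm _, ⟨m (σ y) / m y, fun k => ?_⟩,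
      fun k : ℤ => (σ ^ k) y, ?_, fun z => Iff.rfl, fun k => rfl, fun k => ?_⟩
    · simp only [← hratio, add_comm k, zpow_one_add, Equiv.Perm.mul_apply]
    · intro (j : ℤ) (k : ℤ) (hjk : (σ ^ j) y = (σ ^ k) y)
      by_contra hne
      wlog hlt : j < k generalizing j k
      · exact this hjk.symm (Ne.symm hne) (lt_of_le_of_ne (not_lt.1 hlt) (Ne.symm hne))
      -- A coincidence of two powers would make `k - j` a positive period of `y`.
      refine hy (Function.mk_mem_periodicPts (n := (k - j).toNat) (by lia) ?_)
      rw [Function.IsPeriodicPt, Function.IsFixedPt, Equiv.Perm.iterate_eq_pow, ← zpow_natCast,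
        Int.toNat_of_nonneg (by lia), sub_eq_add_neg, add_comm, zpow_add, Equiv.Perm.mul_apply,
        ← hjk, ← Equiv.Perm.mul_apply, ← zpow_add, neg_add_cancel, zpow_zero, Equiv.Perm.one_apply]
    · revert k
      intro (k : ℤ)
      change (σ ^ (k + 1)) y = σ ((σ ^ k) y)
      rw [add_comm, zpow_one_add, Equiv.Perm.mul_apply]

end PosSeq

/-! ### Assembling the equivalence -/

/-- Since `e` preserves masses and intertwines `next` with `φ`, the unitary that reindexes along `e`
matches the two pointwise graph conditions. -/
theorem compOp_unitarilyEquiv_orthogonalSum_shift {X ι : Type*} [Countable X] [MeasurableSpace X]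
    [DiscreteMeasurableSpace X] {μ : Measure X} (hμ : ∀ x, μ {x} ≠ ∞) {φ : X → X}
    {hφ : Measure.QuasiMeasurePreserving φ μ μ} {γ : ι → PosSeq}
    (e : (Σ i, (γ i).Index) ≃ {x // μ {x} ≠ 0})
    (hterm : ∀ i k, (γ i).term k = μ.real {(e ⟨i, k⟩ : X)})
    (hnext : ∀ i k, (e ⟨i, (γ i).next k⟩ : X) = φ (e ⟨i, k⟩)) :
    (compOp μ φ hφ).UnitarilyEquiv (LinearPMap.orthogonalSum fun i => (γ i).shift) := by
  obtain ⟨U, hU⟩ := L2.exists_unitary_lp hμ (fun i => (γ i).measure_singleton_ne_zero)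
    (fun i => (γ i).measure_singleton_ne_top) e
    (fun i k => ((γ i).measure_real_singleton k).trans (hterm i k))
  refine LinearPMap.unitarilyEquiv_iff_graph.2 ⟨U, fun f g => ?_⟩
  simp only [mem_graph_compOp_iff, LinearPMap.mem_graph_orthogonalSum_iff,
    PosSeq.mem_graph_shift_iff, hU, hnext]
  constructor
  · exact fun h i k => h _ (e ⟨i, k⟩).2
  · intro h x hx
    obtain ⟨⟨i, k⟩, hk⟩ := e.surjective ⟨x, hx⟩
    simpa [hk] using h i k

end

theorem proposition3p6 {X : Type*} [Countable X] [MeasurableSpace X] [DiscreteMeasurableSpace X]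
    (μ : Measure X) [SigmaFinite μ] (φ : X → X)
    (hφ : Measure.QuasiMeasurePreserving φ μ μ) :
    (compOp μ φ hφ).IsNormalOp ↔
      ∃ (J : Set X) (γ : J → PosSeq),
        J ⊆ {x | μ {x} ≠ 0} ∧ (∀ x, (γ x).IsGeometric) ∧
          (compOp μ φ hφ).UnitarilyEquiv (LinearPMap.orthogonalSum fun x => (γ x).shift) := by
  have hμ : ∀ x, μ {x} ≠ ∞ := fun x => measure_singleton_lt_top.ne
  constructor
  · intro hn
    obtain ⟨σ, hσ, hr⟩ := exists_perm_of_compOp_isNormalOp hμ hn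
    choose s hs o hinj horb hterm hnext using PosSeq.exists_isGeometric_orbit σ
      (m := fun x => μ.real {(x : X)}) (fun x => ENNReal.toReal_pos x.2 (hμ _)) hr
    let rep : {x // μ {x} ≠ 0} → {x // μ {x} ≠ 0} :=
      fun y => (Quotient.mk (Equiv.Perm.SameCycle.setoid σ) y).out
    have hrep : ∀ y, σ.SameCycle (rep y) y := fun y => 
      Quotient.mk_out (s := Equiv.Perm.SameCycle.setoid σ) y
    have hrep_eq : ∀ {y z}, σ.SameCycle y z → rep y = rep z := fun h =>
      congrArg Quotient.out (Quotient.sound (s := Equiv.Perm.SameCycle.setoid σ) h)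
    -- Fixed points of `rep` are the chosen representatives, one for each orbit of atoms.
    let J : Set X := {x | ∃ h : μ {x} ≠ 0, rep ⟨x, h⟩ = ⟨x, h⟩}
    let pt : J → {x // μ {x} ≠ 0} := fun x => ⟨x, x.2.1⟩
    have hpt : ∀ x, rep (pt x) = pt x := fun x => x.2.2
    let e : (Σ x : J, (s (pt x)).Index) → {x // μ {x} ≠ 0} := fun p => o (pt p.1) p.2
    have he : Function.Bijective e := by
      constructor
      · rintro ⟨x, k⟩ ⟨x', k'⟩ (hxx : o (pt x) k = o (pt x') k')
        have h1 : σ.SameCycle (pt x) (pt x') :=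
          ((horb _ _).2 ⟨k, hxx⟩).trans ((horb _ _).2 ⟨k', rfl⟩).symm
        have h2 : pt x = pt x' := by rw [← hpt x, ← hpt x', hrep_eq h1]
        obtain rfl : x = x' := Subtype.ext (congrArg (fun y : {x // μ {x} ≠ 0} => (y : X)) h2)
        rw [hinj _ hxx]
      · intro y
        have hJ : (rep y : X) ∈ J := ⟨(rep y).2, hrep_eq (hrep y)⟩
        obtain ⟨k, hk⟩ := (horb _ _).1 (hrep y)
        exact ⟨⟨⟨rep y, hJ⟩, k⟩, hk⟩
    refine ⟨J, fun x => s (pt x), fun x hx => hx.1, fun x => hs _, ?_⟩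
    refine compOp_unitarilyEquiv_orthogonalSum_shift hμ (Equiv.ofBijective e he)
      (fun x k => hterm _ _) fun x k => ?_
    change (o (pt x) ((s (pt x)).next k) : X) = φ (o (pt x) k)
    rw [hnext, hσ]
  · rintro ⟨J, γ, -, hγ, hU⟩
    choose c V hV using fun x => (hγ x).shift_eq_smul_unitary
    exact (LinearPMap.isNormalOp_orthogonalSum_of_smul_unitary c V hV).of_unitarilyEquiv hU
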